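/- Work in $\ell^2=\ell^2(\mathbb Z;\mathbb R)$ with its norm $\|\cdot\|$, and write $(\delta^\pm q)_j:=\pm(q_{j\pm1}-q_j)$. Let $V:\mathbb R\to\mathbb R$ be $C^\infty$ with $V(0)=V'(0)=0$ and $k:=V''(0)>0$; $V'(R)$ and $V''(R)q$ denote the sequences $V'(R_j)$ and $V''(R_j)q_j$. For $\kappa,\mu>0$ put $$\|(R,P,r,p)\|_\mu:=\sqrt{\tfrac k2\|R\|^2+\tfrac12\|P\|^2+\tfrac\kappa2\|r\|^2+\tfrac\mu2\|p\|^2}.$$ Then there is $\rho_*=\rho_*(V)>0$ such that for all $\kappa,K_*,T_*>0$ there are $\mu_*=\mu_*(K_*,T_*,\kappa,V)>0$ and $C_*=C_*(K_*,T_*,\kappa,V)>0$ for which the following holds for every $\mu\in(0,\mu_*]$. All equations are understood as ODEs in $\ell^2$ on the time interval $[-T_*,T_*]$. Suppose that $(\tilde R,\tilde P)$ solves the FPUT system with rescaled potential $$\dot{\tilde R}=\delta^+\tilde P,\qquad \dot{\tilde P}=\frac1{1+\mu}\,\delta^-[V'(\tilde R)],\qquad \|\tilde R(0)\|+\|\tilde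 P(0)\|\le\rho_*,$$ and that $(\tilde r,\tilde p)$ solves the driven harmonic oscillators $$\dot{\tilde r}=\tilde p-\tilde P,\qquad \mu\dot{\tilde p}=-\kappa\tilde r$$ with $$\Big\|\tilde r(0)+\frac\mu\kappa\delta^-[V'(\tilde R(0))]\Big\|+\sqrt\mu\,\Big\|\tilde p(0)-\tilde P(0)+\frac\mu\kappa\delta^-[V''(\tilde R(0))\,\delta^+\tilde P(0)]\Big\|\le K_*\mu^2 .$$ Suppose further that $(R,P,r,p)$ solves the mass-in-mass (MiM) lattice $$\dot R=\delta^+P,\qquad \dot P=\delta^-[V'(R)]+\kappa r,\qquad \dot r=p-P,\qquad \mu\dot p=-\kappa r$$ with $$\|(R(0),P(0),r(0),p(0))-(\tilde R(0),\tilde P(0),\tilde r(0),\tilde p(0))\|_\mu\le K_*\mu^2 .$$ Then $$\|(R(t),P(t),r(t),p(t))-(\tilde R(t),\tilde P(t),\tilde r(t),\tilde p(t))\|_\mu\le C_*\mu^2\qquad\text{for all }t\in[-T_*,T_*].$$ -/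

import Mathlib

open scoped ContDiff

noncomputable section

namespace MiM

/-- The real Hilbert space `ℓ²(ℤ)`; its norm is `‖x‖ = (∑ⱼ xⱼ²)^(1/2)`. -/
abbrev ell2 : Type := lp (fun _ : ℤ => ℝ) 2

theorem memℓp_two_iff (x : ℤ → ℝ) : Memℓp x 2 ↔ Summable fun j => (x j) ^ 2 := by
  rw [memℓp_gen_iff (by norm_num)]
  simp

/-- A sequence that is pointwise dominated by a multiple of an `ℓ²` sequence is in `ℓ²`. -/
theorem memℓp_of_le (q : ell2) (x : ℤ → ℝ) (C : ℝ) (h : ∀ j, |x j| ≤ C * |q j|) :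
    Memℓp x 2 := by
  rw [memℓp_two_iff]
  have hq : Summable fun j => (q j) ^ 2 := (memℓp_two_iff _).1 (lp.memℓp q)
  refine Summable.of_nonneg_of_le (fun j => sq_nonneg _) (fun j => ?_) (hq.mul_left (C ^ 2))
  rw [← sq_abs (x j), ← sq_abs (q j), ← mul_pow]
  exact pow_le_pow_left₀ (abs_nonneg _) (h j) 2

theorem abs_apply_le (x : ell2) (j : ℤ) : |x j| ≤ ‖x‖ := by
  simpa using lp.norm_apply_le_norm (by norm_num) x j

/-- `(shift n q)ⱼ = qⱼ₊ₙ`. -/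
def shift (n : ℤ) (q : ell2) : ell2 :=
  ⟨fun j => q (j + n), (memℓp_two_iff _).2
    (((memℓp_two_iff _).1 (lp.memℓp q)).comp_injective (add_left_injective n))⟩

/-- Forward difference `(δ⁺q)ⱼ = qⱼ₊₁ - qⱼ`. -/
def dplus (q : ell2) : ell2 := shift 1 q - q

/-- Backward difference `(δ⁻q)ⱼ = qⱼ - qⱼ₋₁`. -/
def dminus (q : ell2) : ell2 := q - shift (-1) q

theorem memℓp_force (V : ℝ → ℝ) (hV : ContDiff ℝ ∞ V) (h0 : deriv V 0 = 0) (x : ell2) :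
    Memℓp (fun j : ℤ => deriv V (x j)) 2 := by
  have h1 : ContDiff ℝ 1 (deriv V) :=
    (contDiff_infty_iff_deriv.1 hV).2.of_le (by exact_mod_cast le_top)
  have hc : Continuous (deriv (deriv V)) := h1.continuous_deriv le_rfl
  obtain ⟨C, hC⟩ := (isCompact_Icc (a := -‖x‖) (b := ‖x‖)).exists_bound_of_continuousOn
    hc.continuousOn
  refine memℓp_of_le x _ C fun j => ?_
  have hj := abs_le.1 (abs_apply_le x j)
  have := (convex_Icc (-‖x‖) ‖x‖).norm_image_sub_le_of_norm_deriv_le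
    (f := deriv V) (x := 0) (y := x j) (C := C)
    (fun y _ => (h1.differentiable one_ne_zero).differentiableAt) hC
    ⟨by simp, by simp⟩ ⟨hj.1, hj.2⟩
  simpa [h0] using this

theorem memℓp_stiffness (V : ℝ → ℝ) (hV : ContDiff ℝ ∞ V) (x q : ell2) :
    Memℓp (fun j : ℤ => deriv (deriv V) (x j) * q j) 2 := by
  have h1 : ContDiff ℝ 1 (deriv V) :=
    (contDiff_infty_iff_deriv.1 hV).2.of_le (by exact_mod_cast le_top)
  have hc : Continuous (deriv (deriv V)) := h1.continuous_deriv le_rfl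
  obtain ⟨C, hC⟩ := (isCompact_Icc (a := -‖x‖) (b := ‖x‖)).exists_bound_of_continuousOn
    hc.continuousOn
  refine memℓp_of_le q _ C fun j => ?_
  have hj := abs_le.1 (abs_apply_le x j)
  rw [abs_mul]
  exact mul_le_mul_of_nonneg_right (by simpa using hC (x j) ⟨hj.1, hj.2⟩) (abs_nonneg _)

/-- The sequence `V'(R)`, i.e. `j ↦ V'(Rⱼ)`, as an element of `ℓ²`. -/
def force (V : ℝ → ℝ) (hV : ContDiff ℝ ∞ V) (h0 : deriv V 0 = 0) (R : ell2) : ell2 :=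
  ⟨fun j => deriv V (R j), memℓp_force V hV h0 R⟩

/-- The sequence `V''(R) q`, i.e. `j ↦ V''(Rⱼ) qⱼ`, as an element of `ℓ²`. -/
def stiffness (V : ℝ → ℝ) (hV : ContDiff ℝ ∞ V) (R q : ell2) : ell2 :=
  ⟨fun j => deriv (deriv V) (R j) * q j, memℓp_stiffness V hV R q⟩

/-- `‖(R,P,r,p)‖_μ = √( (k/2)‖R‖² + (1/2)‖P‖² + (κ/2)‖r‖² + (μ/2)‖p‖² )`. -/
def muNorm (k κ μ : ℝ) (R P r p : ell2) : ℝ :=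
  √(k / 2 * ‖R‖ ^ 2 + 1 / 2 * ‖P‖ ^ 2 + κ / 2 * ‖r‖ ^ 2 + μ / 2 * ‖p‖ ^ 2)

/-- `(r, p)` solves the harmonic oscillators driven by `P` on `[-T, T]`, as an ODE in `(ℓ²)²`:
`r' = p - P`, `μ p' = -κ r`. At the end points the derivatives are one-sided. -/
structure SolvesOscillator (κ μ T : ℝ) (P r p : ℝ → ell2) : Prop where
  r_eq : ∀ t ∈ Set.Icc (-T) T,
    HasDerivWithinAt r (p t - P t) (Set.Icc (-T) T) t
  p_eq : ∀ t ∈ Set.Icc (-T) T,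
    HasDerivWithinAt (fun s => μ • p s) (-(κ • r t)) (Set.Icc (-T) T) t

/-- `(R, P)` solves the FPUT system with potential `V / (1 + μ)` on `[-T, T]`, as an ODE in
`(ℓ²)²`: `R' = δ⁺P`, `P' = (1 + μ)⁻¹ δ⁻[V'(R)]`. -/
structure SolvesFPUT (V : ℝ → ℝ) (hV : ContDiff ℝ ∞ V) (h0 : deriv V 0 = 0) (μ T : ℝ)
    (R P : ℝ → ell2) : Prop where
  R_eq : ∀ t ∈ Set.Icc (-T) T,
    HasDerivWithinAt R (dplus (P t)) (Set.Icc (-T) T) t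
  P_eq : ∀ t ∈ Set.Icc (-T) T,
    HasDerivWithinAt P ((1 / (1 + μ)) • dminus (force V hV h0 (R t))) (Set.Icc (-T) T) t

/-- `(R, P, r, p)` solves the mass-in-mass lattice on `[-T, T]`, as an ODE in `(ℓ²)⁴`:
`R' = δ⁺P`, `P' = δ⁻[V'(R)] + κ r`, `r' = p - P`, `μ p' = -κ r`. -/
structure SolvesMiM (V : ℝ → ℝ) (hV : ContDiff ℝ ∞ V) (h0 : deriv V 0 = 0) (κ μ T : ℝ)
    (R P r p : ℝ → ell2) : Prop where
  R_eq : ∀ t ∈ Set.Icc (-T) T,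
    HasDerivWithinAt R (dplus (P t)) (Set.Icc (-T) T) t
  P_eq : ∀ t ∈ Set.Icc (-T) T,
    HasDerivWithinAt P (dminus (force V hV h0 (R t)) + κ • r t) (Set.Icc (-T) T) t
  r_eq : ∀ t ∈ Set.Icc (-T) T,
    HasDerivWithinAt r (p t - P t) (Set.Icc (-T) T) t
  p_eq : ∀ t ∈ Set.Icc (-T) T,
    HasDerivWithinAt (fun s => μ • p s) (-(κ • r t)) (Set.Icc (-T) T) t

end MiM

end

noncomputable section

namespace MiM

open Set Filter Topology

/-! The squared μ-norm of the difference between the two solutions is used as an energy. In its time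
derivative the stiff coupling terms between momenta and oscillators cancel exactly, so no negative
power of μ appears. What remains is controlled by the energy itself, plus `κ⟨b, e⟩`, where `b` is
the momentum difference and `e = r̃ + (μ/κ) P̃'` is the residual of the FPUT solution in the MiM
lattice. If `e = O(μ²)`, Gronwall gives the claim (`exists_stability_bound`).

The residual estimate (`exists_oscillator_bound`) says that a stiff, slowly driven oscillator
started near its quasi-stationary state stays there. Subtracting the expansion up to `(μ²/κ²) P̃'''`
leaves an oscillator with forcing of order `μ²`, again treated by its energy.

This needs bounds on the derivatives of `P̃` that are uniform in μ. Near the origin the FPUT energy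
is comparable to the squared norm, so small data stay small for all times (`exists_fput_bound`).
Superposition operators are smooth on `ℓ²`, so the ODE turns these bounds into bounds for all
derivatives (`reg_fput`). -/

/-! ### Shifts, differences and products on `ℓ²`. -/

theorem norm_sq_eq_tsum (x : ell2) : ‖x‖ ^ 2 = ∑' j, (x j) ^ 2 := by
  rw [← real_inner_self_eq_norm_sq, lp.inner_eq_tsum]
  simp [sq]

theorem summable_sq (x : ell2) : Summable fun j => (x j) ^ 2 :=
  (memℓp_two_iff _).1 (lp.memℓp x)

theorem norm_le_of_abs_le (x y : ell2) {C : ℝ} (hC : 0 ≤ C) (h : ∀ j, |y j| ≤ C * |x j|) :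
    ‖y‖ ≤ C * ‖x‖ := by
  refine le_of_sq_le_sq ?_ (by positivity)
  rw [mul_pow, norm_sq_eq_tsum, norm_sq_eq_tsum, ← tsum_mul_left]
  refine (summable_sq y).tsum_le_tsum (fun j => ?_) ((summable_sq x).mul_left _)
  rw [← sq_abs (x j), ← sq_abs (y j), ← mul_pow]
  exact pow_le_pow_left₀ (abs_nonneg _) (h j) 2

@[simp] theorem shift_apply (n : ℤ) (q : ell2) (j : ℤ) : shift n q j = q (j + n) := rfl

theorem norm_shift (n : ℤ) (q : ell2) : ‖shift n q‖ = ‖q‖ := by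
  have : ‖shift n q‖ ^ 2 = ‖q‖ ^ 2 := by
    rw [norm_sq_eq_tsum, norm_sq_eq_tsum]
    exact (Equiv.addRight n).tsum_eq fun j => (q j) ^ 2
  exact (sq_eq_sq₀ (norm_nonneg _) (norm_nonneg _)).1 this

theorem inner_shift (n : ℤ) (x y : ell2) :
    inner ℝ (shift n x) y = inner ℝ x (shift (-n) y) := by
  rw [lp.inner_eq_tsum, lp.inner_eq_tsum,
    ← (Equiv.addRight n).tsum_eq fun j => inner ℝ (x j) (shift (-n) y j)]
  simp

/-- The shift as a continuous linear map. -/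
def shiftL (n : ℤ) : ell2 →L[ℝ] ell2 :=
  LinearMap.mkContinuous
    { toFun := shift n
      map_add' := fun _ _ => rfl
      map_smul' := fun _ _ => rfl } 1 fun x => by
      rw [one_mul]
      exact (norm_shift n x).le

/-- The forward difference as a continuous linear map. -/
def dplusL : ell2 →L[ℝ] ell2 := shiftL 1 - ContinuousLinearMap.id ℝ ell2

/-- The backward difference as a continuous linear map. -/
def dminusL : ell2 →L[ℝ] ell2 := ContinuousLinearMap.id ℝ ell2 - shiftL (-1)

theorem dplusL_apply (x : ell2) : dplusL x = dplus x := rfl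

theorem dminusL_apply (x : ell2) : dminusL x = dminus x := rfl

theorem norm_dplus_le (x : ell2) : ‖dplus x‖ ≤ 2 * ‖x‖ := by
  have := norm_sub_le (shift 1 x) x
  rw [norm_shift] at this
  unfold dplus
  linarith

theorem norm_dminus_le (x : ell2) : ‖dminus x‖ ≤ 2 * ‖x‖ := by
  have := norm_sub_le x (shift (-1) x)
  rw [norm_shift] at this
  unfold dminus
  linarith

theorem inner_dplus (x y : ell2) : inner ℝ (dplus x) y = -inner ℝ x (dminus y) := by
  rw [dplus, dminus, inner_sub_left, inner_sub_right, inner_shift]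
  ring

/-- Pointwise multiplication of square-summable sequences. -/
def mulL : ell2 →L[ℝ] ell2 →L[ℝ] ell2 :=
  LinearMap.mkContinuous₂
    (LinearMap.mk₂ ℝ
      (fun x y : ell2 => (⟨fun j => x j * y j, memℓp_of_le y _ ‖x‖ fun j => by
        rw [abs_mul]
        exact mul_le_mul_of_nonneg_right (abs_apply_le x j) (abs_nonneg _)⟩ : ell2))
      (fun x y z => by ext j; exact add_mul (x j) (y j) (z j))
      (fun c x y => by ext j; exact mul_assoc c (x j) (y j))
      (fun x y z => by ext j; exact mul_add (x j) (y j) (z j))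
      (fun c x y => by ext j; exact mul_left_comm (x j) c (y j))) 1
    fun x y => by
      rw [one_mul]
      refine norm_le_of_abs_le y _ (norm_nonneg x) fun j => ?_
      change |x j * y j| ≤ _
      rw [abs_mul]
      exact mul_le_mul_of_nonneg_right (abs_apply_le x j) (abs_nonneg _)

@[simp] theorem mulL_apply (x y : ell2) (j : ℤ) : mulL x y j = x j * y j := rfl

/-! ### Superposition operators and their derivatives. -/

theorem exists_deriv_bound {g : ℝ → ℝ} (hg : ContDiff ℝ ∞ g) (r : ℝ) :
    ∃ C, 0 ≤ C ∧ ∀ x ∈ Icc (-r) r, |deriv g x| ≤ C := by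
  have hc : Continuous (deriv g) := (contDiff_infty_iff_deriv.1 hg).2.continuous
  obtain ⟨C, hC⟩ := (isCompact_Icc (a := -r) (b := r)).exists_bound_of_continuousOn
    hc.continuousOn
  exact ⟨|C|, abs_nonneg _, fun x hx => (hC x hx).trans (le_abs_self C)⟩

theorem abs_sub_le_of_deriv_bound {g : ℝ → ℝ} (hg : Differentiable ℝ g) {s : Set ℝ}
    (hs : Convex ℝ s) {C : ℝ} (hC : ∀ x ∈ s, |deriv g x| ≤ C) {x y : ℝ} (hx : x ∈ s)
    (hy : y ∈ s) : |g y - g x| ≤ C * |y - x| :=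
  hs.norm_image_sub_le_of_norm_deriv_le (fun z _ => hg z) hC hx hy

/-- Mean value inequality for `y ↦ g y - g'(a) y` on the segment between `a` and `b`; the sharp
factor 1/2 is not needed. -/
theorem taylor_one_le {g : ℝ → ℝ} (hg : ContDiff ℝ ∞ g) {r C : ℝ} (hC0 : 0 ≤ C)
    (hC : ∀ x ∈ Icc (-r) r, |deriv (deriv g) x| ≤ C) {a b : ℝ} (ha : a ∈ Icc (-r) r)
    (hb : b ∈ Icc (-r) r) : |g b - g a - deriv g a * (b - a)| ≤ C * (b - a) ^ 2 := by
  have hd : Differentiable ℝ g := hg.differentiable (by simp)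
  have hd1 : Differentiable ℝ (deriv g) :=
    (contDiff_infty_iff_deriv.1 hg).2.differentiable (by simp)
  have hsub : uIcc a b ⊆ Icc (-r) r := uIcc_subset_Icc ha hb
  have key : ∀ y, HasDerivAt (fun y => g y - deriv g a * y) (deriv g y - deriv g a) y := fun y => by
    simpa using (hd y).hasDerivAt.fun_sub ((hasDerivAt_id y).const_mul (deriv g a))
  have := abs_sub_le_of_deriv_bound (g := fun y => g y - deriv g a * y) (s := uIcc a b)
    (C := C * |b - a|) (fun y => (key y).differentiableAt) (convex_uIcc a b)
    (fun y hy => by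
      rw [(key y).deriv]
      refine (abs_sub_le_of_deriv_bound hd1 (convex_Icc (-r) r) hC ha (hsub hy)).trans ?_
      exact mul_le_mul_of_nonneg_left (abs_sub_left_of_mem_uIcc hy) hC0)
    left_mem_uIcc right_mem_uIcc
  calc _ = |g b - deriv g a * b - (g a - deriv g a * a)| := by ring_nf
    _ ≤ _ := this
    _ = _ := by rw [mul_assoc, abs_mul_abs_self, sq]

theorem apply_mem_Icc (x : ell2) {r : ℝ} (h : ‖x‖ ≤ r) (j : ℤ) : x j ∈ Icc (-r) r :=
  abs_le.1 ((abs_apply_le x j).trans h)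

theorem memℓp_comp {g : ℝ → ℝ} (hg : ContDiff ℝ ∞ g) (h0 : g 0 = 0) (x : ell2) :
    Memℓp (fun j : ℤ => g (x j)) 2 := by
  obtain ⟨C, -, hC⟩ := exists_deriv_bound hg ‖x‖
  refine memℓp_of_le x _ C fun j => ?_
  simpa [h0] using abs_sub_le_of_deriv_bound (hg.differentiable (by simp)) (convex_Icc _ _) hC
    (x := 0) (by simp) (apply_mem_Icc x le_rfl j)

/-- The superposition operator `x ↦ (g (xⱼ))ⱼ` on `ℓ²`. -/
def comp (g : ℝ → ℝ) (hg : ContDiff ℝ ∞ g) (h0 : g 0 = 0) (x : ell2) : ell2 :=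
  ⟨fun j => g (x j), memℓp_comp hg h0 x⟩

@[simp] theorem comp_apply (g : ℝ → ℝ) (hg : ContDiff ℝ ∞ g) (h0 : g 0 = 0) (x : ell2) (j : ℤ) :
    comp g hg h0 x j = g (x j) := rfl

theorem comp_lipschitz {g : ℝ → ℝ} (hg : ContDiff ℝ ∞ g) (h0 : g 0 = 0) (r : ℝ) :
    ∃ C, 0 ≤ C ∧ ∀ x y : ell2, ‖x‖ ≤ r → ‖y‖ ≤ r →
      ‖comp g hg h0 x - comp g hg h0 y‖ ≤ C * ‖x - y‖ := by
  obtain ⟨C, hC0, hC⟩ := exists_deriv_bound hg r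
  refine ⟨C, hC0, fun x y hx hy => norm_le_of_abs_le _ _ hC0 fun j => ?_⟩
  exact abs_sub_le_of_deriv_bound (hg.differentiable (by simp)) (convex_Icc _ _) hC
    (apply_mem_Icc y hy j) (apply_mem_Icc x hx j)

theorem comp_zero {g : ℝ → ℝ} (hg : ContDiff ℝ ∞ g) (h0 : g 0 = 0) : comp g hg h0 0 = 0 := by
  ext j
  simp [h0]

theorem contDiff_deriv_sub {g : ℝ → ℝ} (hg : ContDiff ℝ ∞ g) :
    ContDiff ℝ ∞ fun x => deriv g x - deriv g 0 :=
  (contDiff_infty_iff_deriv.1 hg).2.sub contDiff_const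

/-- The derivative of `comp g`, split into its value at the origin and an `ℓ²` multiplier. -/
def compDeriv (g : ℝ → ℝ) (hg : ContDiff ℝ ∞ g) (x q : ell2) : ell2 :=
  deriv g 0 • q + mulL (comp (fun y => deriv g y - deriv g 0) (contDiff_deriv_sub hg) (by simp) x) q

@[simp] theorem compDeriv_apply (g : ℝ → ℝ) (hg : ContDiff ℝ ∞ g) (x q : ell2) (j : ℤ) :
    compDeriv g hg x q j = deriv g (x j) * q j := by
  change deriv g 0 * q j + (deriv g (x j) - deriv g 0) * q j = _
  ring

theorem hasFDerivAt_of_quadratic {E F : Type*} [NormedAddCommGroup E] [NormedSpace ℝ E]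
    [NormedAddCommGroup F] [NormedSpace ℝ F] {f : E → F} {L : E →L[ℝ] F} {x : E} {C : ℝ}
    (h : ∀ y, ‖y - x‖ ≤ 1 → ‖f y - f x - L (y - x)‖ ≤ C * ‖y - x‖ ^ 2) : HasFDerivAt f L x := by
  rw [hasFDerivAt_iff_isLittleO]
  have h1 : (fun y => f y - f x - L (y - x)) =O[𝓝 x] fun y => ‖y - x‖ ^ 2 := by
    refine Asymptotics.IsBigO.of_bound C ?_
    filter_upwards [Metric.closedBall_mem_nhds x one_pos] with y hy
    simpa using h y (by simpa [dist_eq_norm] using hy)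
  refine h1.trans_isLittleO ?_
  have h2 : Tendsto (fun y => ‖y - x‖) (𝓝 x) (𝓝 0) := by
    have : Continuous fun y => ‖y - x‖ := by fun_prop
    simpa using this.tendsto x
  have h3 : (fun y => ‖y - x‖ * ‖y - x‖) =o[𝓝 x] fun y => (1 : ℝ) * ‖y - x‖ :=
    ((Asymptotics.isLittleO_one_iff ℝ).2 h2).mul_isBigO (Asymptotics.isBigO_refl _ _)
  simpa [sq] using h3.norm_right.of_norm_right

/-- The Taylor remainder is pointwise quadratic, and `ℓ² ⊂ ℓ^∞` bounds one of the two factors `|yⱼ -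
xⱼ|` by `‖y - x‖`, so the remainder is quadratic in `ℓ²`. -/
theorem hasFDerivAt_comp {g : ℝ → ℝ} (hg : ContDiff ℝ ∞ g) (h0 : g 0 = 0) (x : ell2) :
    HasFDerivAt (comp g hg h0) (deriv g 0 • ContinuousLinearMap.id ℝ ell2 +
      mulL (comp (fun y => deriv g y - deriv g 0) (contDiff_deriv_sub hg) (by simp) x)) x := by
  obtain ⟨C, hC0, hC⟩ := exists_deriv_bound (contDiff_infty_iff_deriv.1 hg).2 (‖x‖ + 1)
  refine hasFDerivAt_of_quadratic (C := C) fun y hy => ?_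
  have hy' : ‖y‖ ≤ ‖x‖ + 1 := by
    have := norm_add_le x (y - x)
    rw [add_sub_cancel] at this
    linarith
  rw [sq, ← mul_assoc]
  refine norm_le_of_abs_le (y - x) _ (by positivity) fun j => ?_
  change |g (y j) - g (x j) - compDeriv g hg x (y - x) j| ≤ _
  rw [compDeriv_apply]
  refine (taylor_one_le hg hC0 hC (apply_mem_Icc x (by linarith) j)
    (apply_mem_Icc y hy' j)).trans ?_
  change C * ((y - x) j) ^ 2 ≤ _
  rw [← sq_abs, sq, ← mul_assoc]
  gcongr
  exact abs_apply_le _ j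

theorem hasDerivWithinAt_comp {g : ℝ → ℝ} (hg : ContDiff ℝ ∞ g) (h0 : g 0 = 0) {x : ℝ → ell2}
    {x' : ell2} {s : Set ℝ} {t : ℝ} (hx : HasDerivWithinAt x x' s t) :
    HasDerivWithinAt (fun t => comp g hg h0 (x t)) (compDeriv g hg (x t) x') s t :=
  (hasFDerivAt_comp hg h0 (x t)).comp_hasDerivWithinAt t hx

theorem stiffness_eq_compDeriv (V : ℝ → ℝ) (hV : ContDiff ℝ ∞ V) (x q : ell2) :
    stiffness V hV x q = compDeriv (deriv V) (contDiff_infty_iff_deriv.1 hV).2 x q := by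
  ext j
  rw [compDeriv_apply]
  rfl

/-! ### The potential energy and its gradient. -/

/-- The potential energy `∑ⱼ V(xⱼ)`. -/
def potential (V : ℝ → ℝ) (x : ell2) : ℝ := ∑' j, V (x j)

theorem abs_potential_le {V : ℝ → ℝ} (hV : ContDiff ℝ ∞ V) (hV0 : V 0 = 0) (h0 : deriv V 0 = 0)
    {r C : ℝ} (hC0 : 0 ≤ C) (hC : ∀ y ∈ Icc (-r) r, |deriv (deriv V) y| ≤ C) (x : ell2)
    (hx : ‖x‖ ≤ r) : Summable (fun j => V (x j)) ∧ |potential V x| ≤ C * ‖x‖ ^ 2 := by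
  have hb : ∀ j, ‖V (x j)‖ ≤ C * (x j) ^ 2 := fun j => by
    have hr : 0 ≤ r := (norm_nonneg x).trans hx
    simpa [hV0, h0] using taylor_one_le hV hC0 hC (a := 0) (by simp [hr]) (apply_mem_Icc x hx j)
  have hs := (summable_sq x).mul_left C
  refine ⟨hs.of_norm_bounded hb, ?_⟩
  rw [norm_sq_eq_tsum, ← tsum_mul_left]
  exact tsum_of_norm_bounded hs.hasSum hb

theorem summable_potential {V : ℝ → ℝ} (hV : ContDiff ℝ ∞ V) (hV0 : V 0 = 0) (h0 : deriv V 0 = 0)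
    (x : ell2) : Summable fun j => V (x j) := by
  obtain ⟨C, hC0, hC⟩ := exists_deriv_bound (contDiff_infty_iff_deriv.1 hV).2 ‖x‖
  exact (abs_potential_le hV hV0 h0 hC0 hC x le_rfl).1

theorem hasFDerivAt_potential {V : ℝ → ℝ} (hV : ContDiff ℝ ∞ V) (hV0 : V 0 = 0)
    (h0 : deriv V 0 = 0) (x : ell2) :
    HasFDerivAt (potential V) (innerSL ℝ (force V hV h0 x)) x := by
  obtain ⟨C, hC0, hC⟩ := exists_deriv_bound (contDiff_infty_iff_deriv.1 hV).2 (‖x‖ + 1)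
  refine hasFDerivAt_of_quadratic (C := C) fun y hy => ?_
  have hy' : ‖y‖ ≤ ‖x‖ + 1 := by
    have := norm_add_le x (y - x)
    rw [add_sub_cancel] at this
    linarith
  have hsi : Summable fun j => inner ℝ (force V hV h0 x j) ((y - x) j) := lp.summable_inner _ _
  have h1 : potential V y - potential V x - innerSL ℝ (force V hV h0 x) (y - x) =
      ∑' j, (V (y j) - V (x j) - inner ℝ (force V hV h0 x j) ((y - x) j)) := by
    rw [Summable.tsum_sub ((summable_potential hV hV0 h0 y).sub (summable_potential hV hV0 h0 x))
      hsi, Summable.tsum_sub (summable_potential hV hV0 h0 y) (summable_potential hV hV0 h0 x),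
      innerSL_apply_apply, lp.inner_eq_tsum]
    rfl
  rw [h1, norm_sq_eq_tsum, ← tsum_mul_left]
  refine tsum_of_norm_bounded ((summable_sq (y - x)).mul_left C).hasSum fun j => ?_
  have := taylor_one_le hV hC0 hC (apply_mem_Icc x (by linarith) j) (apply_mem_Icc y hy' j)
  rw [mul_comm (deriv V (x j))] at this
  exact this

/-! ### Families of curves with uniformly bounded derivatives. -/

/-- `Reg n s u`: the curves `u i` have `n` derivatives on `s`, all of them bounded uniformly in
`i`. -/
def Reg {ι E : Type*} [NormedAddCommGroup E] [NormedSpace ℝ E] (s : Set ℝ) :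
    ℕ → (ι → ℝ → E) → Prop
  | 0, u => ∃ C, ∀ i, ∀ t ∈ s, ‖u i t‖ ≤ C
  | n + 1, u => (∃ C, ∀ i, ∀ t ∈ s, ‖u i t‖ ≤ C) ∧
      ∃ u' : ι → ℝ → E, (∀ i, ∀ t ∈ s, HasDerivWithinAt (u i) (u' i t) s t) ∧ Reg s n u'

namespace Reg

variable {ι E F G : Type*} [NormedAddCommGroup E] [NormedSpace ℝ E] [NormedAddCommGroup F]
  [NormedSpace ℝ F] [NormedAddCommGroup G] [NormedSpace ℝ G] {s : Set ℝ} {n : ℕ}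

theorem bounded {u : ι → ℝ → E} (h : Reg s n u) : ∃ C, ∀ i, ∀ t ∈ s, ‖u i t‖ ≤ C := by
  cases n with
  | zero => exact h
  | succ n => exact h.1

theorem of_succ {u : ι → ℝ → E} (h : Reg s (n + 1) u) : Reg s n u := by
  induction n generalizing u with
  | zero => exact h.1
  | succ n ih =>
    obtain ⟨hb, u', hu, hr⟩ := h
    exact ⟨hb, u', hu, ih hr⟩

theorem add {u v : ι → ℝ → E} (hu : Reg s n u) (hv : Reg s n v) :
    Reg s n fun i t => u i t + v i t := by
  have hb : ∃ C, ∀ i, ∀ t ∈ s, ‖u i t + v i t‖ ≤ C := by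
    obtain ⟨C, hC⟩ := hu.bounded
    obtain ⟨D, hD⟩ := hv.bounded
    exact ⟨C + D, fun i t ht => norm_add_le_of_le (hC i t ht) (hD i t ht)⟩
  induction n generalizing u v with
  | zero => exact hb
  | succ n ih =>
    obtain ⟨_, u', hu', hur⟩ := hu
    obtain ⟨_, v', hv', hvr⟩ := hv
    refine ⟨hb, _, fun i t ht => (hu' i t ht).fun_add (hv' i t ht), ih hur hvr ?_⟩
    obtain ⟨C, hC⟩ := hur.bounded
    obtain ⟨D, hD⟩ := hvr.bounded
    exact ⟨C + D, fun i t ht => norm_add_le_of_le (hC i t ht) (hD i t ht)⟩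

theorem smul {u : ι → ℝ → E} (c : ι → ℝ) {M : ℝ} (hc : ∀ i, |c i| ≤ M) (hu : Reg s n u) :
    Reg s n fun i t => c i • u i t := by
  have key : ∀ {w : ι → ℝ → E}, (∃ C, ∀ i, ∀ t ∈ s, ‖w i t‖ ≤ C) →
      ∃ C, ∀ i, ∀ t ∈ s, ‖c i • w i t‖ ≤ C := by
    rintro w ⟨C, hC⟩
    refine ⟨M * C, fun i t ht => ?_⟩
    rw [norm_smul]
    exact mul_le_mul (hc i) (hC i t ht) (norm_nonneg _) ((abs_nonneg _).trans (hc i))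
  induction n generalizing u with
  | zero => exact key hu
  | succ n ih =>
    obtain ⟨hb, u', hu', hur⟩ := hu
    exact ⟨key hb, _, fun i t ht => (hu' i t ht).fun_const_smul (c i), ih hur⟩

theorem clm {u : ι → ℝ → E} (L : E →L[ℝ] F) (hu : Reg s n u) : Reg s n fun i t => L (u i t) := by
  have key : ∀ {w : ι → ℝ → E}, (∃ C, ∀ i, ∀ t ∈ s, ‖w i t‖ ≤ C) →
      ∃ C, ∀ i, ∀ t ∈ s, ‖L (w i t)‖ ≤ C := by
    rintro w ⟨C, hC⟩
    exact ⟨‖L‖ * C, fun i t ht => L.le_opNorm_of_le (hC i t ht)⟩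
  induction n generalizing u with
  | zero => exact key hu
  | succ n ih =>
    obtain ⟨hb, u', hu', hur⟩ := hu
    exact ⟨key hb, _, fun i t ht => L.hasFDerivAt.comp_hasDerivWithinAt t (hu' i t ht), ih hur⟩

theorem bilin {u : ι → ℝ → E} {v : ι → ℝ → F} (L : E →L[ℝ] F →L[ℝ] G) (hu : Reg s n u)
    (hv : Reg s n v) : Reg s n fun i t => L (u i t) (v i t) := by
  have hb : ∃ C, ∀ i, ∀ t ∈ s, ‖L (u i t) (v i t)‖ ≤ C := by
    obtain ⟨C, hC⟩ := hu.bounded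
    obtain ⟨D, hD⟩ := hv.bounded
    exact ⟨‖L‖ * C * D, fun i t ht => L.le_of_opNorm₂_le_of_le le_rfl (hC i t ht) (hD i t ht)⟩
  induction n generalizing u v with
  | zero => exact hb
  | succ n ih =>
    have hu0 := hu.of_succ
    have hv0 := hv.of_succ
    obtain ⟨_, u', hu', hur⟩ := hu
    obtain ⟨_, v', hv', hvr⟩ := hv
    have key : ∀ {u : ι → ℝ → E} {v : ι → ℝ → F}, Reg s n u → Reg s n v →
        Reg s n fun i t => L (u i t) (v i t) := fun {u v} hu hv => by
      refine ih hu hv ?_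
      obtain ⟨C, hC⟩ := hu.bounded
      obtain ⟨D, hD⟩ := hv.bounded
      exact ⟨‖L‖ * C * D, fun i t ht => L.le_of_opNorm₂_le_of_le le_rfl (hC i t ht) (hD i t ht)⟩
    exact ⟨hb, _, fun i t ht => L.hasDerivWithinAt_of_bilinear (hu' i t ht) (hv' i t ht),
      (key hu0 hvr).add (key hur hv0)⟩

/-- Regularity of the multiplier is a hypothesis here, so that the induction step of `Reg.comp` can
supply it from the induction hypothesis. -/
theorem compDeriv_of_comp {g : ℝ → ℝ} (hg : ContDiff ℝ ∞ g) {u v : ι → ℝ → ell2}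
    (hu : Reg s n fun i t => comp (fun y => deriv g y - deriv g 0) (contDiff_deriv_sub hg)
      (by simp) (u i t)) (hv : Reg s n v) : Reg s n fun i t => compDeriv g hg (u i t) (v i t) :=
  (hv.smul (fun _ => deriv g 0) (M := |deriv g 0|) fun _ => le_rfl).add (bilin mulL hu hv)

/-- The chain rule produces `g'(u)`, which is not in `ℓ²` unless `g'(0) = 0`. The constant `g'(0)`
is split off, and the induction, which generalizes `g`, continues with `g' - g'(0)`. -/
theorem comp {g : ℝ → ℝ} (hg : ContDiff ℝ ∞ g) (h0 : g 0 = 0) {u : ι → ℝ → ell2}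
    (hu : Reg s n u) : Reg s n fun i t => comp g hg h0 (u i t) := by
  have hb : ∃ C, ∀ i, ∀ t ∈ s, ‖MiM.comp g hg h0 (u i t)‖ ≤ C := by
    obtain ⟨C, hC⟩ := hu.bounded
    obtain ⟨D, hD0, hD⟩ := comp_lipschitz hg h0 C
    refine ⟨D * C, fun i t ht => ?_⟩
    have hut := hC i t ht
    have := hD (u i t) 0 hut (by simpa using (norm_nonneg _).trans hut)
    rw [comp_zero, sub_zero, sub_zero] at this
    exact this.trans (mul_le_mul_of_nonneg_left hut hD0)
  induction n generalizing g u with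
  | zero => exact hb
  | succ n ih =>
    have hu0 := hu.of_succ
    obtain ⟨_, u', hu', hur⟩ := hu
    refine ⟨hb, _, fun i t ht => hasDerivWithinAt_comp hg h0 (hu' i t ht),
      compDeriv_of_comp hg (ih (contDiff_deriv_sub hg) (by simp) hu0 ?_) hur⟩
    obtain ⟨C, hC⟩ := hu0.bounded
    obtain ⟨D, hD0, hD⟩ := comp_lipschitz (contDiff_deriv_sub hg) (by simp) C
    refine ⟨D * C, fun i t ht => ?_⟩
    have hut := hC i t ht
    have := hD (u i t) 0 hut (by simpa using (norm_nonneg _).trans hut)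
    rw [comp_zero, sub_zero, sub_zero] at this
    exact this.trans (mul_le_mul_of_nonneg_left hut hD0)

theorem compDeriv {g : ℝ → ℝ} (hg : ContDiff ℝ ∞ g) {u v : ι → ℝ → ell2} (hu : Reg s n u)
    (hv : Reg s n v) : Reg s n fun i t => compDeriv g hg (u i t) (v i t) :=
  compDeriv_of_comp hg (hu.comp (contDiff_deriv_sub hg) (by simp)) hv

end Reg

/-! ### Gronwall estimates with a barrier. -/

/-- The barrier `B(x) = (f 0 + η) exp((L + 1) x) - η` satisfies `B' = (L + 1)(B + η) > L (B + η)`;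
the rate `L + 1` and `η > 0` make this strict. Where `f` touches `B` it lies between `0` and `M`, so
`hf'` applies and `f` cannot cross. -/
theorem le_barrier_right {T L η M : ℝ} (hL : 0 ≤ L) (hη : 0 < η) {f f' : ℝ → ℝ}
    (hf : ∀ t ∈ Icc 0 T, HasDerivWithinAt f (f' t) (Icc 0 T) t) (h0 : 0 ≤ f 0)
    (hM : (f 0 + η) * Real.exp ((L + 1) * T) ≤ M)
    (hf' : ∀ t ∈ Icc 0 T, 0 ≤ f t → f t ≤ M → f' t ≤ L * (f t + η)) {t : ℝ} (ht : t ∈ Icc 0 T) :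
    f t ≤ (f 0 + η) * Real.exp ((L + 1) * T) := by
  have hpos : ∀ x, 0 < (f 0 + η) * Real.exp ((L + 1) * x) := fun x => by positivity
  have hmono : ∀ x ∈ Icc 0 T, (f 0 + η) * Real.exp ((L + 1) * x) ≤
      (f 0 + η) * Real.exp ((L + 1) * T) := fun x hx => by
    have := hx.2
    gcongr
  have hone : ∀ x ∈ Icc 0 T, f 0 + η ≤ (f 0 + η) * Real.exp ((L + 1) * x) := fun x hx =>
    le_mul_of_one_le_right (by linarith) (Real.one_le_exp (mul_nonneg (by linarith) hx.1))
  have hB : ∀ x, HasDerivAt (fun x => (f 0 + η) * Real.exp ((L + 1) * x) - η)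
      ((L + 1) * ((f 0 + η) * Real.exp ((L + 1) * x))) x := fun x => by
    have := ((((hasDerivAt_id x).const_mul (L + 1)).exp).const_mul (f 0 + η)).sub_const η
    refine this.congr_deriv ?_
    simp only [id]
    ring
  have := image_le_of_deriv_right_lt_deriv_boundary (f := f) (f' := f') (a := 0) (b := T)
    (fun t ht => (hf t ht).continuousWithinAt)
    (fun x hx => (hf x (Ico_subset_Icc_self hx)).mono_of_mem_nhdsWithin
      (Icc_mem_nhdsGE_of_mem hx)) (by simp) hB
    (fun x hx hfx => by
      have hx' := Ico_subset_Icc_self hx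
      have h1 := hone x hx'
      have h2 := hmono x hx'
      have h3 := hpos x
      have := hf' x hx' (by linarith) (by linarith)
      rw [hfx, sub_add_cancel] at this
      linarith) ht
  have h2 := hmono t ht
  linarith

/-- A two-sided Gronwall estimate in which the differential inequality is only required as long
as the quantity stays below a level `M` that the resulting bound does not exceed. -/
theorem le_barrier {T L η M : ℝ} (hL : 0 ≤ L) (hη : 0 < η) {f f' : ℝ → ℝ}
    (hf : ∀ t ∈ Icc (-T) T, HasDerivWithinAt f (f' t) (Icc (-T) T) t) (h0 : 0 ≤ f 0)
    (hM : (f 0 + η) * Real.exp ((L + 1) * T) ≤ M)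
    (hf' : ∀ t ∈ Icc (-T) T, 0 ≤ f t → f t ≤ M → |f' t| ≤ L * (f t + η)) {t : ℝ}
    (ht : t ∈ Icc (-T) T) : f t ≤ (f 0 + η) * Real.exp ((L + 1) * T) := by
  have hT : 0 ≤ T := by linarith [ht.1, ht.2]
  rcases le_total 0 t with h | h
  · have hsub : Icc 0 T ⊆ Icc (-T) T := Icc_subset_Icc_left (by linarith)
    exact le_barrier_right hL hη (fun t ht => (hf t (hsub ht)).mono hsub) h0 hM
      (fun t ht h1 h2 => (le_abs_self _).trans (hf' t (hsub ht) h1 h2)) ⟨h, ht.2⟩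
  -- Negative times follow by time reversal, which flips the sign of `f'`; hence the bound on
  -- `|f'|`.
  · have hsub : ∀ t ∈ Icc 0 T, -t ∈ Icc (-T) T := fun t ht =>
      ⟨by linarith [ht.2], by linarith [ht.1]⟩
    have := le_barrier_right (f := fun t => f (-t)) (f' := fun t => -f' (-t)) (M := M) hL hη
      (T := T) (fun t ht =>
        (HasDerivWithinAt.scomp t (hf _ (hsub t ht)) (hasDerivWithinAt_neg t _)
          (fun x hx => hsub x hx)).congr_deriv (by simp)) (by simpa using h0) (by simpa using hM)
      (fun t ht h1 h2 => (neg_le_abs _).trans (hf' _ (hsub t ht) h1 h2)) (t := -t)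
      ⟨by linarith, by linarith [ht.1]⟩
    simpa using this

/-! ### Energy conservation and uniform bounds for FPUT solutions. -/

/-- By continuity of `V''`, the remainder `V - k y²/2` has second derivative at most `k/4` in
absolute value near 0, so the potential energy differs from `(k/2)‖x‖²` by at most `(k/4)‖x‖²`. -/
theorem exists_potential_bounds {V : ℝ → ℝ} (hV : ContDiff ℝ ∞ V) (hV0 : V 0 = 0)
    (hV1 : deriv V 0 = 0) (hV2 : 0 < deriv (deriv V) 0) :
    ∃ r, 0 < r ∧ ∀ x : ell2, ‖x‖ ≤ r → deriv (deriv V) 0 / 4 * ‖x‖ ^ 2 ≤ potential V x ∧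
      potential V x ≤ 3 * deriv (deriv V) 0 / 4 * ‖x‖ ^ 2 := by
  set k := deriv (deriv V) 0 with hk
  have hV' := (contDiff_infty_iff_deriv.1 hV).2
  have hd : Differentiable ℝ V := hV.differentiable (by simp)
  have hd1 : Differentiable ℝ (deriv V) := hV'.differentiable (by simp)
  have hc : Continuous (deriv (deriv V)) := (contDiff_infty_iff_deriv.1 hV').2.continuous
  obtain ⟨r, hr, hrV⟩ := Metric.continuousAt_iff.1 (hc.continuousAt (x := 0)) (k / 4) (by linarith)
  have hW : ContDiff ℝ ∞ fun y => V y - k / 2 * y ^ 2 := by fun_prop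
  have hW1 : deriv (fun y => V y - k / 2 * y ^ 2) = fun y => deriv V y - k * y := by
    funext y
    refine ((hd y).hasDerivAt.fun_sub ((hasDerivAt_pow 2 y).const_mul (k / 2))).deriv.trans ?_
    norm_num
    ring
  have hW2 : deriv (fun y => deriv V y - k * y) = fun y => deriv (deriv V) y - k := by
    funext y
    refine ((hd1 y).hasDerivAt.fun_sub ((hasDerivAt_id y).const_mul k)).deriv.trans ?_
    simp
  refine ⟨r / 2, by linarith, fun x hx => ?_⟩
  obtain ⟨-, h2⟩ := abs_potential_le hW (by simp [hV0]) (by simp [hW1, hV1]) (C := k / 4)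
    (by linarith) (fun y hy => by
      rw [hW1, hW2]
      have := @hrV y (by
        rw [Real.dist_eq, sub_zero]
        linarith [abs_le.2 hy])
      rw [Real.dist_eq] at this
      exact this.le) x hx
  have h3 : potential (fun y => V y - k / 2 * y ^ 2) x = potential V x - k / 2 * ‖x‖ ^ 2 := by
    rw [norm_sq_eq_tsum, ← tsum_mul_left]
    exact (summable_potential hV hV0 hV1 x).tsum_sub ((summable_sq x).mul_left _)
  rw [h3, abs_le] at h2
  constructor <;> linarith

section FPUT

variable {V : ℝ → ℝ} {hV : ContDiff ℝ ∞ V} {hV1 : deriv V 0 = 0} {μ T : ℝ} {R P : ℝ → ell2}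

/-- The two contributions to the derivative cancel because `δ⁺` and `-δ⁻` are adjoint. -/
theorem SolvesFPUT.energy_eq (h : SolvesFPUT V hV hV1 μ T R P) (hV0 : V 0 = 0) {t : ℝ}
    (ht : t ∈ Icc (-T) T) :
    ‖P t‖ ^ 2 + 2 / (1 + μ) * potential V (R t) = ‖P 0‖ ^ 2 + 2 / (1 + μ) * potential V (R 0) := by
  have hT : 0 ≤ T := by linarith [ht.1, ht.2]
  have hE : ∀ s ∈ Icc (-T) T, HasDerivWithinAt
      (fun s => ‖P s‖ ^ 2 + 2 / (1 + μ) * potential V (R s)) 0 (Icc (-T) T) s := fun s hs => by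
    refine ((h.P_eq s hs).norm_sq.fun_add
      (((hasFDerivAt_potential hV hV0 hV1 (R s)).comp_hasDerivWithinAt s
        (h.R_eq s hs)).const_mul (2 / (1 + μ)))).congr_deriv ?_
    rw [innerSL_apply_apply, real_inner_comm (dplus _), inner_dplus, inner_smul_right]
    ring
  have := (convex_Icc (-T) T).norm_image_sub_le_of_norm_hasDerivWithin_le (C := 0) hE
    (fun _ _ => by simp) (x := 0) (y := t) ⟨by linarith, hT⟩ ht
  rw [zero_mul, norm_le_zero_iff, sub_eq_zero] at this
  exact this

/-- Small initial data of the FPUT lattice stay small, by conservation of energy. -/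
theorem exists_fput_bound (hV : ContDiff ℝ ∞ V) (hV0 : V 0 = 0) (hV1 : deriv V 0 = 0)
    (hV2 : 0 < deriv (deriv V) 0) :
    ∃ ρ r, 0 < ρ ∧ 0 < r ∧ ∀ (μ T : ℝ) (R P : ℝ → ell2), 0 < μ → μ ≤ 1 →
      SolvesFPUT V hV hV1 μ T R P → ‖R 0‖ + ‖P 0‖ ≤ ρ →
      ∀ t ∈ Icc (-T) T, ‖R t‖ ≤ r ∧ ‖P t‖ ≤ r := by
  obtain ⟨r, hr, hpot⟩ := exists_potential_bounds hV hV0 hV1 hV2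
  set k := deriv (deriv V) 0 with hk
  -- The initial energy is at most `(1 + 3k/2) ρ²`; it has to lie below `k r²/4`, the least energy
  -- possible at `‖R‖ = r`.
  obtain ⟨ρ, hρ, hρr, hρE⟩ : ∃ ρ, 0 < ρ ∧ ρ < r ∧ (1 + 3 * k / 2) * ρ ^ 2 < k / 4 * r ^ 2 := by
    refine ⟨r * (k / (4 + 8 * k)), by positivity, ?_, ?_⟩
    · have : k / (4 + 8 * k) < 1 := by rw [div_lt_one (by positivity)]; linarith
      nlinarith
    · have h1 : (1 + 3 * k / 2) * (r * (k / (4 + 8 * k))) ^ 2 =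
          k / 4 * r ^ 2 * (4 * (1 + 3 * k / 2) * k / (4 + 8 * k) ^ 2) := by
        field_simp
      rw [h1]
      refine mul_lt_of_lt_one_right (by positivity) ?_
      rw [div_lt_one (by positivity)]
      nlinarith [sq_nonneg k]
  refine ⟨ρ, r + √k * r, hρ, by positivity, fun μ T R P hμ hμ1 h hini t ht => ?_⟩
  have hT : 0 ≤ T := by linarith [ht.1, ht.2]
  have hmem0 : (0 : ℝ) ∈ Icc (-T) T := ⟨by linarith, hT⟩
  have hR0 : ‖R 0‖ ≤ ρ := by linarith [norm_nonneg (P 0)]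
  have hP0 : ‖P 0‖ ≤ ρ := by linarith [norm_nonneg (R 0)]
  -- Since `μ ≤ 1`, the weight of the potential stays in `[1, 2]`, so `ρ` does not depend on μ.
  have hθ1 : 1 ≤ 2 / (1 + μ) := by rw [le_div_iff₀ (by linarith)]; linarith
  have hθ2 : 2 / (1 + μ) ≤ 2 := by rw [div_le_iff₀ (by linarith)]; linarith
  have hE0 : ‖P 0‖ ^ 2 + 2 / (1 + μ) * potential V (R 0) < k / 4 * r ^ 2 := by
    obtain ⟨h1, h2⟩ := hpot (R 0) (by linarith)
    have h3 : ‖R 0‖ ^ 2 ≤ ρ ^ 2 := pow_le_pow_left₀ (norm_nonneg _) hR0 2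
    have h4 : ‖P 0‖ ^ 2 ≤ ρ ^ 2 := pow_le_pow_left₀ (norm_nonneg _) hP0 2
    have h5 : 2 / (1 + μ) * potential V (R 0) ≤ 2 * potential V (R 0) :=
      mul_le_mul_of_nonneg_right hθ2 (le_trans (by positivity) h1)
    have h6 := mul_le_mul_of_nonneg_left h3 (by positivity : 0 ≤ 3 * k / 4)
    linarith
  have hlow : ∀ s ∈ Icc (-T) T, ‖R s‖ ≤ r →
      ‖P s‖ ^ 2 + k / 4 * ‖R s‖ ^ 2 < k / 4 * r ^ 2 := fun s hs hRs => by
    obtain ⟨h1, -⟩ := hpot (R s) hRs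
    have h2 : potential V (R s) ≤ 2 / (1 + μ) * potential V (R s) :=
      le_mul_of_one_le_left (le_trans (by positivity) h1) hθ1
    have := h.energy_eq hV0 hs
    linarith
  -- Trapping: leaving the ball would force `‖R s‖ = r` at some time `s`, which the energy excludes.
  have hRt : ‖R t‖ ≤ r := by
    by_contra! hlt
    have hcont : ContinuousOn (fun s => ‖R s‖) (Icc (-T) T) := fun s hs =>
      (h.R_eq s hs).continuousWithinAt.norm
    obtain ⟨s, hs, hsr⟩ := isPreconnected_Icc.intermediate_value hmem0 ht hcont
      (show r ∈ Icc ‖R 0‖ ‖R t‖ from ⟨by linarith, hlt.le⟩)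
    have hsr' : ‖R s‖ = r := hsr
    have := hlow s hs hsr'.le
    rw [hsr'] at this
    linarith [sq_nonneg ‖P s‖]
  have hPt : ‖P t‖ ≤ √k * r := by
    refine le_of_sq_le_sq ?_ (by positivity)
    rw [mul_pow, Real.sq_sqrt hV2.le]
    have := hlow t ht hRt
    have h1 : 0 ≤ k / 4 * ‖R t‖ ^ 2 := by positivity
    have h2 : 0 ≤ k * r ^ 2 := by positivity
    linarith
  have h1 : 0 ≤ √k * r := by positivity
  constructor <;> linarith

/-- A uniformly bounded family of FPUT solutions has uniformly bounded derivatives of all orders. -/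
theorem reg_fput {ι : Type*} {hV : ContDiff ℝ ∞ V} {m : ι → ℝ} {R P : ι → ℝ → ell2}
    (hm : ∀ i, 0 < m i) (h : ∀ i, SolvesFPUT V hV hV1 (m i) T (R i) (P i)) {r : ℝ}
    (hb : ∀ i, ∀ t ∈ Icc (-T) T, ‖R i t‖ ≤ r ∧ ‖P i t‖ ≤ r) (n : ℕ) :
    Reg (Icc (-T) T) n R ∧ Reg (Icc (-T) T) n P := by
  have hRb : ∃ C, ∀ i, ∀ t ∈ Icc (-T) T, ‖R i t‖ ≤ C := ⟨r, fun i t ht => (hb i t ht).1⟩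
  have hPb : ∃ C, ∀ i, ∀ t ∈ Icc (-T) T, ‖P i t‖ ≤ C := ⟨r, fun i t ht => (hb i t ht).2⟩
  induction n with
  | zero => exact ⟨hRb, hPb⟩
  | succ n ih =>
    refine ⟨⟨hRb, _, fun i t ht => (h i).R_eq t ht, ih.2.clm dplusL⟩,
      ⟨hPb, _, fun i t ht => (h i).P_eq t ht, ?_⟩⟩
    refine (((ih.1.comp (contDiff_infty_iff_deriv.1 hV).2 hV1).clm dminusL).smul
      (fun i => 1 / (1 + m i)) (M := 1) fun i => ?_)
    have := hm i
    rw [abs_of_pos (by positivity), div_le_one (by positivity)]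
    linarith

/-- The differentiated curve is `P'`, so this computes `P''`. -/
theorem SolvesFPUT.hasDerivWithinAt_force (h : SolvesFPUT V hV hV1 μ T R P) {t : ℝ}
    (ht : t ∈ Icc (-T) T) :
    HasDerivWithinAt (fun t => (1 / (1 + μ)) • dminus (force V hV hV1 (R t)))
      ((1 / (1 + μ)) • dminus (stiffness V hV (R t) (dplus (P t)))) (Icc (-T) T) t := by
  have := hasDerivWithinAt_comp (contDiff_infty_iff_deriv.1 hV).2 hV1 (h.R_eq t ht)
  rw [← stiffness_eq_compDeriv] at this
  exact (dminusL.hasFDerivAt.comp_hasDerivWithinAt t this).fun_const_smul _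

/-- Uniform bounds for the momenta of small FPUT solutions and their first four derivatives. -/
theorem exists_fput_deriv_bounds (hV : ContDiff ℝ ∞ V) (hV1 : deriv V 0 = 0) (T r : ℝ) :
    ∃ M, 0 ≤ M ∧ ∀ (μ : ℝ) (R P : ℝ → ell2), 0 < μ → SolvesFPUT V hV hV1 μ T R P →
      (∀ t ∈ Icc (-T) T, ‖R t‖ ≤ r ∧ ‖P t‖ ≤ r) →
      ∃ P₃ P₄ : ℝ → ell2,
        (∀ t ∈ Icc (-T) T, HasDerivWithinAt
          (fun t => (1 / (1 + μ)) • dminus (stiffness V hV (R t) (dplus (P t))))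
          (P₃ t) (Icc (-T) T) t) ∧
        (∀ t ∈ Icc (-T) T, HasDerivWithinAt P₃ (P₄ t) (Icc (-T) T) t) ∧
        ∀ t ∈ Icc (-T) T, ‖(1 / (1 + μ)) • dminus (force V hV hV1 (R t))‖ ≤ M ∧
          ‖(1 / (1 + μ)) • dminus (stiffness V hV (R t) (dplus (P t)))‖ ≤ M ∧
          ‖P₃ t‖ ≤ M ∧ ‖P₄ t‖ ≤ M := by
  -- Indexing by all admissible μ and all bounded solutions makes the bounds of `Reg` uniform in
  -- both.
  let ι := {x : ℝ × (ℝ → ell2) × (ℝ → ell2) // 0 < x.1 ∧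
    SolvesFPUT V hV hV1 x.1 T x.2.1 x.2.2 ∧
    ∀ t ∈ Icc (-T) T, ‖x.2.1 t‖ ≤ r ∧ ‖x.2.2 t‖ ≤ r}
  obtain ⟨hR, hP⟩ := reg_fput (ι := ι) (hV1 := hV1) (T := T) (m := fun i => i.1.1)
    (R := fun i => i.1.2.1) (P := fun i => i.1.2.2) (fun i => i.2.1) (fun i => i.2.2.1)
    (fun i => i.2.2.2) 2
  have hθ : ∀ i : ι, |1 / (1 + i.1.1)| ≤ 1 := fun i => by
    have := i.2.1
    rw [abs_of_pos (by positivity), div_le_one (by positivity)]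
    linarith
  have h1 := ((hR.comp (contDiff_infty_iff_deriv.1 hV).2 hV1).clm dminusL).smul
    (fun i : ι => 1 / (1 + i.1.1)) hθ
  have h2 := ((hR.compDeriv (contDiff_infty_iff_deriv.1 hV).2 (hP.clm dplusL)).clm dminusL).smul
    (fun i : ι => 1 / (1 + i.1.1)) hθ
  simp only [dminusL_apply, dplusL_apply] at h2
  obtain ⟨M₁, hM₁⟩ := h1.bounded
  obtain ⟨⟨M₂, hM₂⟩, P₃, hP₃, ⟨M₃, hM₃⟩, P₄, hP₄, M₄, hM₄⟩ := h2
  refine ⟨|M₁| + |M₂| + |M₃| + |M₄|, by positivity, fun μ R P hμ h hb => ?_⟩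
  let i : ι := ⟨(μ, R, P), hμ, h, hb⟩
  simp only [stiffness_eq_compDeriv]
  refine ⟨P₃ i, P₄ i, hP₃ i, hP₄ i, fun t ht => ?_⟩
  have a1 := le_abs_self M₁
  have a2 := le_abs_self M₂
  have a3 := le_abs_self M₃
  have a4 := le_abs_self M₄
  have b1 := abs_nonneg M₁
  have b2 := abs_nonneg M₂
  have b3 := abs_nonneg M₃
  have b4 := abs_nonneg M₄
  refine ⟨(hM₁ i t ht).trans ?_, (hM₂ i t ht).trans ?_, (hM₃ i t ht).trans ?_,
    (hM₄ i t ht).trans ?_⟩ <;> linarith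

end FPUT

/-! ### The driven stiff oscillator. -/

theorem hasDerivWithinAt_of_smul {μ : ℝ} (hμ : μ ≠ 0) {p : ℝ → ell2} {p' : ell2} {s : Set ℝ}
    {t : ℝ} (h : HasDerivWithinAt (fun s => μ • p s) p' s t) :
    HasDerivWithinAt p (μ⁻¹ • p') s t := by
  simpa [smul_smul, hμ] using h.fun_const_smul μ⁻¹

/-- The slowly driven stiff oscillator follows `r ≈ -(μ/κ) P'` up to an error of order `μ²`. -/
theorem exists_oscillator_bound {κ K T M : ℝ} (hκ : 0 < κ) (hK : 0 < K) (hM : 0 ≤ M) :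
    ∃ C, 0 ≤ C ∧ ∀ (μ : ℝ) (P P₁ P₂ P₃ P₄ r p : ℝ → ell2), 0 < μ → μ ≤ 1 →
      SolvesOscillator κ μ T P r p →
      (∀ t ∈ Icc (-T) T, HasDerivWithinAt P (P₁ t) (Icc (-T) T) t) →
      (∀ t ∈ Icc (-T) T, HasDerivWithinAt P₁ (P₂ t) (Icc (-T) T) t) →
      (∀ t ∈ Icc (-T) T, HasDerivWithinAt P₂ (P₃ t) (Icc (-T) T) t) →
      (∀ t ∈ Icc (-T) T, HasDerivWithinAt P₃ (P₄ t) (Icc (-T) T) t) →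
      (∀ t ∈ Icc (-T) T, ‖P₁ t‖ ≤ M ∧ ‖P₂ t‖ ≤ M ∧ ‖P₃ t‖ ≤ M ∧ ‖P₄ t‖ ≤ M) →
      ‖r 0 + (μ / κ) • (1 + μ) • P₁ 0‖ + √μ * ‖p 0 - P 0 + (μ / κ) • (1 + μ) • P₂ 0‖
        ≤ K * μ ^ 2 →
      ∀ t ∈ Icc (-T) T, ‖r t + (μ / κ) • P₁ t‖ ≤ C * μ ^ 2 := by
  -- `A` and `B` bound `‖a 0‖` and `√μ ‖b 0‖` in units of `μ²`. `N` comes from Young's inequality,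
  -- its `+ 1` keeping the Gronwall offset positive even for `M = 0`.
  set A := K + M / κ + M / κ ^ 2 with hA
  set B := K + M / κ with hB
  set N := M ^ 2 / (2 * κ ^ 3) + 1 with hN
  set D := (κ / 2 * A ^ 2 + 1 / 2 * B ^ 2 + N) * Real.exp ((1 + 1) * T) with hD
  have hN0 : 0 < N := by positivity
  have hD0 : 0 < D := by positivity
  refine ⟨√(2 / κ * D) + M / κ ^ 2, by positivity,
    fun μ P P₁ P₂ P₃ P₄ r p hμ hμ1 h hP hP₁ hP₂ hP₃ hb hini t ht => ?_⟩
  have hT : 0 ≤ T := by linarith [ht.1, ht.2]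
  have hmem0 : (0 : ℝ) ∈ Icc (-T) T := ⟨by linarith, hT⟩
  -- With the `P₃` correction, `a' = b - (μ²/κ²) P₄` and `μ b' = -κ a`: the error enters only the
  -- first equation. Without it, the forcing would be tested against `b`, which the energy controls
  -- only with weight `μ`, costing a factor `√μ`.
  set a : ℝ → ell2 := fun t => r t + (μ / κ) • P₁ t - (μ ^ 2 / κ ^ 2) • P₃ t with ha
  set b : ℝ → ell2 := fun t => p t - P t + (μ / κ) • P₂ t with hbdef
  have ha' : ∀ t ∈ Icc (-T) T,
      HasDerivWithinAt a (b t - (μ ^ 2 / κ ^ 2) • P₄ t) (Icc (-T) T) t := fun t ht =>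
    ((h.r_eq t ht).fun_add ((hP₁ t ht).fun_const_smul _)).fun_sub ((hP₃ t ht).fun_const_smul _)
  have hb' : ∀ t ∈ Icc (-T) T, HasDerivWithinAt b (-(κ / μ) • a t) (Icc (-T) T) t := fun t ht => by
    refine (((hasDerivWithinAt_of_smul hμ.ne' (h.p_eq t ht)).fun_sub (hP t ht)).fun_add
      ((hP₂ t ht).fun_const_smul (μ / κ))).congr_deriv ?_
    simp only [ha]
    match_scalars <;> field_simp
  have hf : ∀ t ∈ Icc (-T) T, HasDerivWithinAt
      (fun t => κ / 2 * ‖a t‖ ^ 2 + μ / 2 * ‖b t‖ ^ 2) (-(μ ^ 2 / κ) * inner ℝ (a t) (P₄ t))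
      (Icc (-T) T) t := fun t ht => by
    refine (((ha' t ht).norm_sq.const_mul (κ / 2)).fun_add
      ((hb' t ht).norm_sq.const_mul (μ / 2))).congr_deriv ?_
    rw [inner_sub_right, inner_smul_right, inner_smul_right, real_inner_comm (a t) (b t)]
    field_simp
    ring
  have hsq : 0 ≤ √μ := Real.sqrt_nonneg μ
  have hsq1 : √μ ≤ 1 := Real.sqrt_le_one.2 hμ1
  have ha0 : ‖a 0‖ ≤ A * μ ^ 2 := by
    obtain ⟨h1, -, h3, -⟩ := hb 0 hmem0
    -- The data are prepared with `(1 + μ) P₁` instead of `P₁`; the discrepancy `(μ²/κ) P₁` is of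
    -- admissible order.
    have e : a 0 = (r 0 + (μ / κ) • (1 + μ) • P₁ 0) - (μ ^ 2 / κ) • P₁ 0 -
        (μ ^ 2 / κ ^ 2) • P₃ 0 := by
      simp only [ha]
      match_scalars <;> (field_simp; try ring)
    have i1 : ‖r 0 + (μ / κ) • (1 + μ) • P₁ 0‖ ≤ K * μ ^ 2 := by
      have := mul_nonneg hsq (norm_nonneg (p 0 - P 0 + (μ / κ) • (1 + μ) • P₂ 0))
      linarith
    have i2 : ‖(μ ^ 2 / κ) • P₁ 0‖ ≤ μ ^ 2 / κ * M := by
      rw [norm_smul, Real.norm_of_nonneg (by positivity)]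
      gcongr
    have i3 : ‖(μ ^ 2 / κ ^ 2) • P₃ 0‖ ≤ μ ^ 2 / κ ^ 2 * M := by
      rw [norm_smul, Real.norm_of_nonneg (by positivity)]
      gcongr
    rw [e]
    refine (norm_sub_le_of_le (norm_sub_le_of_le i1 i2) i3).trans (le_of_eq ?_)
    rw [hA]
    ring
  have hb0 : √μ * ‖b 0‖ ≤ B * μ ^ 2 := by
    obtain ⟨-, h2, -, -⟩ := hb 0 hmem0
    have e : b 0 = (p 0 - P 0 + (μ / κ) • (1 + μ) • P₂ 0) - (μ ^ 2 / κ) • P₂ 0 := by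
      simp only [hbdef]
      match_scalars <;> (field_simp; try ring)
    have i1 : √μ * ‖p 0 - P 0 + (μ / κ) • (1 + μ) • P₂ 0‖ ≤ K * μ ^ 2 := by
      have := norm_nonneg (r 0 + (μ / κ) • (1 + μ) • P₁ 0)
      linarith
    have i2 : √μ * ‖(μ ^ 2 / κ) • P₂ 0‖ ≤ μ ^ 2 / κ * M := by
      refine (mul_le_of_le_one_left (norm_nonneg _) hsq1).trans ?_
      rw [norm_smul, Real.norm_of_nonneg (by positivity)]
      gcongr
    rw [e]
    refine (mul_le_mul_of_nonneg_left (norm_sub_le _ _) hsq).trans ?_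
    rw [mul_add]
    refine (add_le_add i1 i2).trans (le_of_eq ?_)
    rw [hB]
    ring
  have hf0 : κ / 2 * ‖a 0‖ ^ 2 + μ / 2 * ‖b 0‖ ^ 2 ≤
      (κ / 2 * A ^ 2 + 1 / 2 * B ^ 2) * μ ^ 4 := by
    have i1 := mul_le_mul_of_nonneg_left (pow_le_pow_left₀ (norm_nonneg _) ha0 2)
      (by positivity : 0 ≤ κ / 2)
    have i2 := pow_le_pow_left₀ (by positivity) hb0 2
    rw [mul_pow, Real.sq_sqrt hμ.le] at i2
    linarith
  -- The differential inequality holds without restriction, so the level `M` of `le_barrier` is the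
  -- bound itself.
  have hbd := le_barrier (η := N * μ ^ 4) zero_le_one (by positivity) hf (by positivity) le_rfl
    (fun t ht _ _ => by
      obtain ⟨-, -, -, h4⟩ := hb t ht
      rw [abs_mul, abs_neg, abs_of_nonneg (by positivity)]
      have i1 : |inner ℝ (a t) (P₄ t)| ≤ ‖a t‖ * M :=
        (abs_real_inner_le_norm _ _).trans (mul_le_mul_of_nonneg_left h4 (norm_nonneg _))
      have i2 := mul_le_mul_of_nonneg_left i1 (by positivity : 0 ≤ μ ^ 2 / κ)
      have i3 : μ ^ 2 / κ * (‖a t‖ * M) ≤ κ / 2 * ‖a t‖ ^ 2 + M ^ 2 / (2 * κ ^ 3) * μ ^ 4 := by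
        have e : κ / 2 * ‖a t‖ ^ 2 + M ^ 2 / (2 * κ ^ 3) * μ ^ 4 - μ ^ 2 / κ * (‖a t‖ * M) =
            κ / 2 * (‖a t‖ - M * μ ^ 2 / κ ^ 2) ^ 2 := by
          field_simp
          ring
        have : 0 ≤ κ / 2 * (‖a t‖ - M * μ ^ 2 / κ ^ 2) ^ 2 := by positivity
        linarith
      have i4 : 0 ≤ μ / 2 * ‖b t‖ ^ 2 := by positivity
      have i5 : 0 ≤ μ ^ 4 := by positivity
      rw [hN]
      linarith) ht
  have hat : ‖a t‖ ≤ √(2 / κ * D) * μ ^ 2 := by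
    refine le_of_sq_le_sq ?_ (by positivity)
    rw [mul_pow, Real.sq_sqrt (by positivity)]
    have i1 : (κ / 2 * ‖a 0‖ ^ 2 + μ / 2 * ‖b 0‖ ^ 2 + N * μ ^ 4) * Real.exp ((1 + 1) * T) ≤
        D * μ ^ 4 := by
      rw [hD, mul_right_comm]
      gcongr
      linarith
    have i2 : 0 ≤ μ / 2 * ‖b t‖ ^ 2 := by positivity
    have i3 : κ / 2 * ‖a t‖ ^ 2 ≤ D * μ ^ 4 := by linarith
    calc ‖a t‖ ^ 2 = 2 / κ * (κ / 2 * ‖a t‖ ^ 2) := by field_simp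
      _ ≤ 2 / κ * (D * μ ^ 4) := by gcongr
      _ = _ := by ring
  have e : r t + (μ / κ) • P₁ t = a t + (μ ^ 2 / κ ^ 2) • P₃ t := by simp [ha]
  have i3 : ‖(μ ^ 2 / κ ^ 2) • P₃ t‖ ≤ μ ^ 2 / κ ^ 2 * M := by
    rw [norm_smul, Real.norm_of_nonneg (by positivity)]
    exact mul_le_mul_of_nonneg_left (hb t ht).2.2.1 (by positivity)
  rw [e]
  refine (norm_add_le_of_le hat i3).trans (le_of_eq ?_)
  ring

/-! ### Stability of the MiM lattice. -/

/-- Stability: an FPUT solution together with an oscillator satisfying `r ≈ -(μ/κ) P'` up to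
`O(μ²)` is shadowed by the mass-in-mass solutions starting nearby. -/
theorem exists_stability_bound {V : ℝ → ℝ} (hV : ContDiff ℝ ∞ V) (hV1 : deriv V 0 = 0)
    {k κ K T C₁ ρ : ℝ} (hk : 0 < k) (hκ : 0 < κ) (hC₁ : 0 ≤ C₁) :
    ∃ μs C : ℝ, 0 < μs ∧ μs ≤ 1 ∧ 0 < C ∧ ∀ μ : ℝ, 0 < μ → μ ≤ μs →
      ∀ Ra Pa ra pa R P r p : ℝ → ell2,
        SolvesFPUT V hV hV1 μ T Ra Pa → SolvesOscillator κ μ T Pa ra pa →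
        SolvesMiM V hV hV1 κ μ T R P r p →
        (∀ t ∈ Icc (-T) T, ‖Ra t‖ ≤ ρ) →
        (∀ t ∈ Icc (-T) T,
          ‖ra t + (μ / κ) • (1 / (1 + μ)) • dminus (force V hV hV1 (Ra t))‖ ≤ C₁ * μ ^ 2) →
        muNorm k κ μ (R 0 - Ra 0) (P 0 - Pa 0) (r 0 - ra 0) (p 0 - pa 0) ≤ K * μ ^ 2 →
        ∀ t ∈ Icc (-T) T,
          muNorm k κ μ (R t - Ra t) (P t - Pa t) (r t - ra t) (p t - pa t) ≤ C * μ ^ 2 := by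
  obtain ⟨Λ, hΛ0, hΛ⟩ := comp_lipschitz (contDiff_infty_iff_deriv.1 hV).2 hV1 (ρ + 1)
  set L := 2 * (k + Λ) * (1 / k + 1) + κ * C₁ with hL
  set D := (K ^ 2 + 1) * Real.exp ((L + 1) * T) with hD
  have hL0 : 0 ≤ L := by positivity
  have hD0 : 0 < D := by positivity
  -- This threshold gives `D μ⁴ ≤ k/2`. While the energy is below `k/2`, `‖R - Ra‖ ≤ 1`, so `R`
  -- stays in the ball of radius `ρ + 1` where `Λ` is a Lipschitz constant of the force.
  refine ⟨min 1 (k / (2 * D)), √D, by positivity, min_le_left _ _, by positivity,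
    fun μ hμ hμs Ra Pa ra pa R P r p hF hO hMM hRa hres hini t ht => ?_⟩
  have hμ1 : μ ≤ 1 := hμs.trans (min_le_left _ _)
  have hμD : D * μ ^ 4 ≤ k / 2 := by
    have h1 : μ ^ 4 ≤ μ := pow_le_of_le_one hμ.le hμ1 (by norm_num)
    calc D * μ ^ 4 ≤ D * (k / (2 * D)) := by
          gcongr
          exact h1.trans (hμs.trans (min_le_right _ _))
      _ = k / 2 := by field_simp
  set a : ℝ → ell2 := fun t => R t - Ra t with ha
  set b : ℝ → ell2 := fun t => P t - Pa t with hb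
  set c : ℝ → ell2 := fun t => r t - ra t with hc
  set d : ℝ → ell2 := fun t => p t - pa t with hd
  set e : ℝ → ell2 := fun t =>
    ra t + (μ / κ) • (1 / (1 + μ)) • dminus (force V hV hV1 (Ra t)) with he
  set F : ℝ → ell2 := fun t => force V hV hV1 (R t) - force V hV hV1 (Ra t) with hFdef
  have hL2 : ∀ x y : ell2, dminus x - dminus y = dminus (x - y) := fun x y =>
    (map_sub dminusL x y).symm
  have hL1 : ∀ x y : ell2, dplus x - dplus y = dplus (x - y) := fun x y =>
    (map_sub dplusL x y).symm
  have ha' : ∀ t ∈ Icc (-T) T, HasDerivWithinAt a (dplus (b t)) (Icc (-T) T) t := fun t ht =>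
    ((hMM.R_eq t ht).fun_sub (hF.R_eq t ht)).congr_deriv (hL1 _ _)
  -- Since `1 - 1/(1+μ) = μ/(1+μ)`, the mismatch of the two force terms and `κ ra` combine into `κ
  -- e`.
  have hb' : ∀ t ∈ Icc (-T) T,
      HasDerivWithinAt b (dminus (F t) + κ • c t + κ • e t) (Icc (-T) T) t := fun t ht => by
    refine ((hMM.P_eq t ht).fun_sub (hF.P_eq t ht)).congr_deriv ?_
    simp only [hFdef, ← hL2, hc, he]
    match_scalars <;> (field_simp; try ring)
  have hc' : ∀ t ∈ Icc (-T) T, HasDerivWithinAt c (d t - b t) (Icc (-T) T) t := fun t ht =>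
    ((hMM.r_eq t ht).fun_sub (hO.r_eq t ht)).congr_deriv (by simp only [hd, hb]; abel)
  have hd' : ∀ t ∈ Icc (-T) T, HasDerivWithinAt d (-(κ / μ) • c t) (Icc (-T) T) t := fun t ht => by
    refine ((hasDerivWithinAt_of_smul hμ.ne' (hMM.p_eq t ht)).fun_sub
      (hasDerivWithinAt_of_smul hμ.ne' (hO.p_eq t ht))).congr_deriv ?_
    simp only [hc]
    match_scalars <;> field_simp
  -- The terms `κ⟨b, c⟩` and `κ⟨c, d⟩` cancel, leaving no factor `1/μ`.
  have hf : ∀ t ∈ Icc (-T) T, HasDerivWithinAt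
      (fun t => k / 2 * ‖a t‖ ^ 2 + 1 / 2 * ‖b t‖ ^ 2 + κ / 2 * ‖c t‖ ^ 2 + μ / 2 * ‖d t‖ ^ 2)
      (k * inner ℝ (a t) (dplus (b t)) + inner ℝ (b t) (dminus (F t)) + κ * inner ℝ (b t) (e t))
      (Icc (-T) T) t := fun t ht => by
    refine (((((ha' t ht).norm_sq.const_mul (k / 2)).fun_add
      ((hb' t ht).norm_sq.const_mul (1 / 2))).fun_add
      ((hc' t ht).norm_sq.const_mul (κ / 2))).fun_add
      ((hd' t ht).norm_sq.const_mul (μ / 2))).congr_deriv ?_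
    simp only [inner_sub_right, inner_add_right, inner_smul_right]
    rw [real_inner_comm (c t) (b t), real_inner_comm (c t) (d t)]
    field_simp
    ring
  have hf0 : k / 2 * ‖a 0‖ ^ 2 + 1 / 2 * ‖b 0‖ ^ 2 + κ / 2 * ‖c 0‖ ^ 2 + μ / 2 * ‖d 0‖ ^ 2 ≤
      K ^ 2 * μ ^ 4 := by
    have := (Real.sqrt_le_left ((Real.sqrt_nonneg _).trans hini)).1 hini
    linarith
  have hf0D : (k / 2 * ‖a 0‖ ^ 2 + 1 / 2 * ‖b 0‖ ^ 2 + κ / 2 * ‖c 0‖ ^ 2 + μ / 2 * ‖d 0‖ ^ 2 +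
      μ ^ 4) * Real.exp ((L + 1) * T) ≤ D * μ ^ 4 := by
    rw [hD, mul_right_comm]
    gcongr
    linarith
  have hbd := le_barrier (η := μ ^ 4) hL0 (by positivity) hf (by positivity)
    (hf0D.trans hμD) (fun t ht _ hle => by
      have hB := norm_nonneg (b t)
      have hA := norm_nonneg (a t)
      have hcn : 0 ≤ κ / 2 * ‖c t‖ ^ 2 := by positivity
      have hdn : 0 ≤ μ / 2 * ‖d t‖ ^ 2 := by positivity
      have hbn : 0 ≤ 1 / 2 * ‖b t‖ ^ 2 := by positivity
      have han : 0 ≤ k / 2 * ‖a t‖ ^ 2 := by positivity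
      have hμ4 : 0 ≤ μ ^ 4 := by positivity
      set f := k / 2 * ‖a t‖ ^ 2 + 1 / 2 * ‖b t‖ ^ 2 + κ / 2 * ‖c t‖ ^ 2 + μ / 2 * ‖d t‖ ^ 2
        with hfdef
      have hf0 : 0 ≤ f := by positivity
      have hA1 : ‖a t‖ ≤ 1 := by
        have : k / 2 * ‖a t‖ ^ 2 ≤ k / 2 * 1 := by linarith
        have := le_of_mul_le_mul_left this (by positivity)
        exact (sq_le_one_iff₀ hA).1 this
      have hR : ‖R t‖ ≤ ρ + 1 := by
        have e : R t = Ra t + a t := by simp [ha]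
        rw [e]
        exact norm_add_le_of_le (hRa t ht) hA1
      have hFt : ‖F t‖ ≤ Λ * ‖a t‖ := hΛ _ _ hR ((hRa t ht).trans (by linarith))
      have i1 : |inner ℝ (a t) (dplus (b t))| ≤ ‖a t‖ * (2 * ‖b t‖) :=
        (abs_real_inner_le_norm _ _).trans (mul_le_mul_of_nonneg_left (norm_dplus_le _) hA)
      have i2 : |inner ℝ (b t) (dminus (F t))| ≤ ‖b t‖ * (2 * (Λ * ‖a t‖)) :=
        (abs_real_inner_le_norm _ _).trans (mul_le_mul_of_nonneg_left
          ((norm_dminus_le _).trans (by linarith)) hB)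
      have i3 : |inner ℝ (b t) (e t)| ≤ ‖b t‖ * (C₁ * μ ^ 2) :=
        (abs_real_inner_le_norm _ _).trans (mul_le_mul_of_nonneg_left (hres t ht) hB)
      have i4 : ‖a t‖ * ‖b t‖ ≤ (1 / k + 1) * f := by
        have j1 : ‖a t‖ * ‖b t‖ ≤ 1 / 2 * ‖a t‖ ^ 2 + 1 / 2 * ‖b t‖ ^ 2 := by
          linarith [sq_nonneg (‖a t‖ - ‖b t‖)]
        have j2 : 1 / 2 * ‖a t‖ ^ 2 ≤ 1 / k * f := by
          calc 1 / 2 * ‖a t‖ ^ 2 = 1 / k * (k / 2 * ‖a t‖ ^ 2) := by field_simp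
            _ ≤ _ := by gcongr; linarith
        linarith
      have i5 : ‖b t‖ * μ ^ 2 ≤ f + μ ^ 4 := by
        linarith [sq_nonneg (‖b t‖ - μ ^ 2)]
      calc _ ≤ |k * inner ℝ (a t) (dplus (b t))| + |inner ℝ (b t) (dminus (F t))| +
            |κ * inner ℝ (b t) (e t)| := abs_add_three _ _ _
        _ ≤ k * (‖a t‖ * (2 * ‖b t‖)) + ‖b t‖ * (2 * (Λ * ‖a t‖)) +
            κ * (‖b t‖ * (C₁ * μ ^ 2)) := by
          rw [abs_mul k, abs_mul κ, abs_of_pos hk, abs_of_pos hκ]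
          gcongr
        _ = 2 * (k + Λ) * (‖a t‖ * ‖b t‖) + κ * C₁ * (‖b t‖ * μ ^ 2) := by ring
        _ ≤ 2 * (k + Λ) * ((1 / k + 1) * f) + κ * C₁ * (f + μ ^ 4) := by gcongr
        _ ≤ 2 * (k + Λ) * ((1 / k + 1) * (f + μ ^ 4)) + κ * C₁ * (f + μ ^ 4) := by
          gcongr
          linarith
        _ = L * (f + μ ^ 4) := by
          rw [hL]
          ring) ht
  refine (Real.sqrt_le_left (by positivity)).2 ?_
  rw [mul_pow, Real.sq_sqrt hD0.le, ← pow_mul]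
  exact hbd.trans hf0D

end MiM

end

/-! ### The main theorem. -/

theorem corollary5p3 (V : ℝ → ℝ) (hV : ContDiff ℝ ∞ V) (hV0 : V 0 = 0)
    (hV1 : deriv V 0 = 0) (hV2 : 0 < deriv (deriv V) 0) :
    ∃ ρ : ℝ, 0 < ρ ∧ ∀ κ K T : ℝ, 0 < κ → 0 < K → 0 < T →
      ∃ μs C : ℝ, 0 < μs ∧ 0 < C ∧ ∀ μ : ℝ, 0 < μ → μ ≤ μs →
        ∀ Ra Pa ra pa R P r p : ℝ → MiM.ell2,
          MiM.SolvesFPUT V hV hV1 μ T Ra Pa →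
          ‖Ra 0‖ + ‖Pa 0‖ ≤ ρ →
          MiM.SolvesOscillator κ μ T Pa ra pa →
          ‖ra 0 + (μ / κ) • MiM.dminus (MiM.force V hV hV1 (Ra 0))‖
              + √μ * ‖pa 0 - Pa 0
                  + (μ / κ) • MiM.dminus (MiM.stiffness V hV (Ra 0) (MiM.dplus (Pa 0)))‖
            ≤ K * μ ^ 2 →
          MiM.SolvesMiM V hV hV1 κ μ T R P r p →
          MiM.muNorm (deriv (deriv V) 0) κ μ
              (R 0 - Ra 0) (P 0 - Pa 0) (r 0 - ra 0) (p 0 - pa 0) ≤ K * μ ^ 2 →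
          ∀ t ∈ Set.Icc (-T) T,
            MiM.muNorm (deriv (deriv V) 0) κ μ
              (R t - Ra t) (P t - Pa t) (r t - ra t) (p t - pa t) ≤ C * μ ^ 2 := by
  obtain ⟨ρ, b, hρ, -, hfput⟩ := MiM.exists_fput_bound hV hV0 hV1 hV2
  refine ⟨ρ, hρ, fun κ K T hκ hK hT => ?_⟩
  obtain ⟨M, hM0, hM⟩ := MiM.exists_fput_deriv_bounds hV hV1 T b
  obtain ⟨C₁, hC₁, hosc⟩ := MiM.exists_oscillator_bound (T := T) hκ hK hM0
  obtain ⟨μs, C, hμs, hμs1, hC, hstab⟩ :=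
    MiM.exists_stability_bound (K := K) (T := T) (ρ := b) hV hV1 hV2 hκ hC₁
  refine ⟨μs, C, hμs, hC, fun μ hμ hμle Ra Pa ra pa R P r p hF hini hO hosc0 hMM hdiff => ?_⟩
  have hμ1 : μ ≤ 1 := hμle.trans hμs1
  have hb := hfput μ T Ra Pa hμ hμ1 hF hini
  obtain ⟨P₃, P₄, hP₃, hP₄, hbd⟩ := hM μ Ra Pa hμ hF hb
  -- This turns `(1 + μ) P'` and `(1 + μ) P''` into the expressions `δ⁻[V'(R)]` and `δ⁻[V''(R) δ⁺P]`
  -- of the prepared initial data.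
  have hθ : (1 + μ) * (1 / (1 + μ)) = 1 := mul_one_div_cancel (by positivity)
  refine hstab μ hμ hμle Ra Pa ra pa R P r p hF hO hMM (fun t ht => (hb t ht).1)
    (hosc μ Pa _ _ P₃ P₄ ra pa hμ hμ1 hO hF.P_eq (fun t ht => hF.hasDerivWithinAt_force ht)
      hP₃ hP₄ hbd ?_) hdiff
  simpa only [smul_smul (1 + μ), hθ, one_smul] using hosc0
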